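/- **Theorem 1.9.** Let $\mathcal H$ be a complex Hilbert space. *Notation.* For a commuting tuple $\mathbf A=(A_1,\dots,A_n)\in B(\mathcal H)^n$ the Taylor spectrum $\sigma_T(\mathbf A)$ is the set of $z\in\mathbb C^n$ for which the Koszul complex of $(A_1-z_1,\dots,A_n-z_n)$ is not exact. This complex is $$0\to E_n\xrightarrow{D_n}E_{n-1}\to\cdots\xrightarrow{D_1}E_0\to 0,\qquad E_k=\mathcal H\otimes\Lambda^k\mathbb C^n,$$ $$D_k(x\otimes e_{j_1}\wedge\dots\wedge e_{j_k})=\sum_{i=1}^k(-1)^{i-1}(A_{j_i}-z_{j_i})x\otimes e_{j_1}\wedge\dots\wedge\check e_{j_i}\wedge\dots\wedge e_{j_k},$$ where $\check e_{j_i}$ means deletion. Fix a generalized limit $\mathrm{glim}$, i.e. a positive linear functional on the bounded complex sequences that extends the ordinary limit. The Berberian extension $\mathcal K$ of $\mathcal H$ is the Hilbert space obtained from the bounded sequences in $\mathcal H$ with the semi-inner product $\langle (x_m),(y_m)\rangle=\mathrm{glim}_m\langle x_m,y_m\rangle$ by dividing out the vectors of seminorm zero and completing. For $A\in B(\mathcal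 H)$, $A^\circ\in B(\mathcal K)$ is the operator with $A^\circ[(x_m)]=[(Ax_m)]$. A closed subspace $\mathcal M$ reduces an operator if it is invariant under the operator and its adjoint. $\sigma$ and $\sigma_p$ denote the spectrum and the point spectrum, and $|A|=(A^*A)^{1/2}$. *Hypotheses.* Let $\mathbf T=(T_1,\dots,T_n)\in B(\mathcal H)^n$ be doubly commuting, i.e. $T_iT_j=T_jT_i$ and $T_iT_j^*=T_j^*T_i$ for all $i\ne j$, and let $T_j=U_j|T_j|$ be polar decompositions with $U_j$ unitary. Let $f$ be a real-valued continuous function on an interval $I\subseteq[0,\infty)$ that contains $\sigma(|T_1|)\cup\dots\cup\sigma(|T_n|)$. Suppose that for every $j$ the following hold with $T=T_j$ and $U=U_j$. 1. For every $z\in\mathbb C$ and every sequence $(x_m)$ of unit vectors of $\mathcal H$, if $(T-z)x_m\to0$, then $(T-z)^*x_m\to0$. 2. For every closed subspace $\mathcal M$ of $\mathcal K$ that reduces $T^\circ$, every $r\ge 0$ and every $\theta\in\mathbb R$, if $re^{i\theta}\in\sigma(T^\circ|_{\mathcal M})$, then $\mathcal M$ reduces $U^\circ$ and $|T|^\circ$,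 and $e^{-i\theta}f(r)\in\sigma_p\big((U^\circ|_{\mathcal M}\,f(|T|^\circ)|_{\mathcal M})^*\big)$. (In 2, $re^{i\theta}\in\sigma(T^\circ|_{\mathcal M})$ forces $r\in I$, so that $f(r)$ is defined.) *Conclusion.* Put $S_j=U_jf(|T_j|)$ and $\mathbf S=(S_1,\dots,S_n)$. Then $\mathbf S$ is a commuting tuple, and for all $r_1,\dots,r_n\ge0$ and $\theta_1,\dots,\theta_n\in\mathbb R$, $$(r_1e^{i\theta_1},\dots,r_ne^{i\theta_n})\in\sigma_T(\mathbf T)\ \Longrightarrow\ (e^{i\theta_1}f(r_1),\dots,e^{i\theta_n}f(r_n))\in\sigma_T(\mathbf S).$$ -/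

import Mathlib

/-! ### Taylor spectrum -/

section Taylor

variable {H : Type*} [NormedAddCommGroup H] [NormedSpace ℂ H]

/-- The space `E^n_k(H) = H ⊗ Λ^k ℂ^n`, written as a direct sum of copies of `H` indexed by the
`k`-element subsets of `Fin n`: the value of `ξ` at `J = {j₁ < ⋯ < j_k}` is the coefficient of
`e_{j₁} ∧ ⋯ ∧ e_{j_k}`. -/
abbrev KoszulSpace (n : ℕ) (H : Type*) (k : ℕ) : Type _ :=
  {J : Finset (Fin n) // J.card = k} → H

/-- The set `L ∪ {j}`, for `j` not in the `k`-element set `L`. -/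
def koszulInsert {n k : ℕ} (L : {J : Finset (Fin n) // J.card = k}) (j : {j : Fin n // j ∉ L.1}) :
    {J : Finset (Fin n) // J.card = k + 1} :=
  ⟨insert j.1 L.1, by rw [Finset.card_insert_of_notMem j.2, L.2]⟩

/-- The Koszul boundary map `D_{k+1} : E^n_{k+1}(H) → E^n_k(H)`,
`D (x ⊗ e_{j₁} ∧ ⋯ ∧ e_{j_{k+1}}) = ∑ i, (-1)^{i-1} T_{j_i} x ⊗ e_{j₁} ∧ ⋯ ě_{j_i} ⋯ ∧ e_{j_{k+1}}`.
The coefficient at `L` collects the terms in which the deletion of `j = j_i` from `J` leaves `L`;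
then `i - 1` is the number of elements of `L` that are smaller than `j`. -/
def koszulD {n : ℕ} (T : Fin n → H →L[ℂ] H) (k : ℕ) :
    KoszulSpace n H (k + 1) →ₗ[ℂ] KoszulSpace n H k where
  toFun ξ L := ∑ j : {j : Fin n // j ∉ L.1},
    (-1 : ℂ) ^ (L.1.filter (· < j.1)).card • T j.1 (ξ (koszulInsert L j))
  map_add' ξ η := by
    funext L
    simp [Finset.sum_add_distrib]
  map_smul' c ξ := by
    funext L
    simp [Finset.smul_sum, smul_comm c]

/-- Exactness of the Koszul complex `0 → E_n → ⋯ → E_1 → E_0 → 0`. The spaces `E_k` with `k > n`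
vanish, so that the condition at `E_n` is injectivity of `D_n`, and for `n = 0` the condition at
`E_0` says `H = 0`. -/
def KoszulExact {n : ℕ} (T : Fin n → H →L[ℂ] H) : Prop :=
  Function.Surjective (koszulD T 0) ∧
    ∀ k : ℕ, Function.Exact (koszulD T (k + 1)) (koszulD T k)

/-- The Taylor spectrum of a (commuting) tuple. -/
def taylorSpectrum {n : ℕ} (T : Fin n → H →L[ℂ] H) : Set (Fin n → ℂ) :=
  {z | ¬ KoszulExact fun j => T j - z j • (1 : H →L[ℂ] H)}

/-- The point spectrum (set of eigenvalues). -/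
def pointSpectrum (A : H →L[ℂ] H) : Set ℂ :=
  {μ | ∃ x : H, x ≠ 0 ∧ A x = μ • x}

end Taylor

section Hilbert

variable {H : Type*} [NormedAddCommGroup H] [InnerProductSpace ℂ H] [CompleteSpace H]

/-- A doubly commuting tuple: `T_i T_j = T_j T_i` and `T_i T_j^* = T_j^* T_i` for `i ≠ j`. -/
def DoublyCommuting {n : ℕ} (T : Fin n → H →L[ℂ] H) : Prop :=
  ∀ i j, i ≠ j → Commute (T i) (T j) ∧ Commute (T i) (ContinuousLinearMap.adjoint (T j))

/-- The closed subspace `M` reduces `A`: it is invariant under `A` and `A^*`. -/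
def Reduces (M : ClosedSubmodule ℂ H) (A : H →L[ℂ] H) : Prop :=
  (∀ x ∈ M.toSubmodule, A x ∈ M.toSubmodule) ∧
    ∀ x ∈ M.toSubmodule, ContinuousLinearMap.adjoint A x ∈ M.toSubmodule

instance (M : ClosedSubmodule ℂ H) : CompleteSpace M.toSubmodule :=
  M.isClosed'.completeSpace_coe

/-- The restriction `A|_M` to a reducing subspace, as an operator on `M`. -/
def Reduces.restrict {M : ClosedSubmodule ℂ H} {A : H →L[ℂ] H} (h : Reduces M A) :
    M.toSubmodule →L[ℂ] M.toSubmodule :=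
  ContinuousLinearMap.restrict A h.1

theorem reduces_iff_commute (M : ClosedSubmodule ℂ H) (A : H →L[ℂ] H) :
    Reduces M A ↔ Commute M.toSubmodule.starProjection A := by
  constructor
  · rintro ⟨h₁, h₂⟩
    refine ContinuousLinearMap.ext fun x => ?_
    have ha : A (M.toSubmodule.starProjection x) ∈ M.toSubmodule :=
      h₁ _ (M.toSubmodule.starProjection_apply_mem x)
    have hb : A (x - M.toSubmodule.starProjection x) ∈ M.toSubmoduleᗮ := by
      intro y hy
      rw [← ContinuousLinearMap.adjoint_inner_left]
      exact M.toSubmodule.sub_starProjection_mem_orthogonal x _ (h₂ y hy)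
    have e₁ := Submodule.starProjection_eq_self_iff.mpr ha
    have e₂ := (Submodule.starProjection_apply_eq_zero_iff _).mpr hb
    rw [map_sub, map_sub, e₁, sub_eq_zero] at e₂
    exact e₂
  · intro h
    have h' : Commute M.toSubmodule.starProjection (ContinuousLinearMap.adjoint A) := by
      have := h.star_star
      rwa [(isSelfAdjoint_starProjection M.toSubmodule).star_eq] at this
    refine ⟨fun x hx => ?_, fun x hx => ?_⟩
    · have := congrArg (fun B : H →L[ℂ] H => B x) h.eq
      simp only [mul_apply_eq_comp, Submodule.starProjection_eq_self_iff.mpr hx] at this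
      exact Submodule.starProjection_eq_self_iff.mp this
    · have := congrArg (fun B : H →L[ℂ] H => B x) h'.eq
      simp only [mul_apply_eq_comp, Submodule.starProjection_eq_self_iff.mpr hx] at this
      exact Submodule.starProjection_eq_self_iff.mp this

/-- A subspace that reduces `A` reduces `f(A)` (continuous functional calculus). -/
theorem Reduces.cfc {M : ClosedSubmodule ℂ H} {A : H →L[ℂ] H} (h : Reduces M A) (f : ℝ → ℝ) :
    Reduces M (cfc f A) := by
  rw [reduces_iff_commute] at h ⊢
  exact (h.symm.cfc_real f).symm

end Hilbert

/-! ### Berberian extension -/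

section Berberian

/-- The space of bounded sequences in `E`. -/
def boundedSeq (E : Type*) [NormedAddCommGroup E] [NormedSpace ℂ E] : Submodule ℂ (ℕ → E) where
  carrier := {x | ∃ C : ℝ, ∀ m, ‖x m‖ ≤ C}
  add_mem' := by
    rintro x y ⟨C, hC⟩ ⟨D, hD⟩
    exact ⟨C + D, fun m => (norm_add_le _ _).trans (add_le_add (hC m) (hD m))⟩
  zero_mem' := ⟨0, fun m => by simp⟩
  smul_mem' := by
    rintro c x ⟨C, hC⟩
    refine ⟨‖c‖ * C, fun m => ?_⟩
    simpa [norm_smul] using mul_le_mul_of_nonneg_left (hC m) (norm_nonneg c)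

/-- A generalized limit on bounded complex sequences: a positive linear functional that extends
the ordinary limit. (Banach limits and limits along free ultrafilters are examples.) -/
structure GeneralizedLimit where
  /-- The functional. -/
  lim : boundedSeq ℂ →ₗ[ℂ] ℂ
  /-- It extends the limit of convergent sequences. -/
  lim_eq : ∀ (a : boundedSeq ℂ) (l : ℂ), Filter.Tendsto a.1 Filter.atTop (nhds l) → lim a = l
  /-- It is positive. -/
  lim_nonneg : ∀ a : boundedSeq ℂ, (∀ m, ∃ t : ℝ, 0 ≤ t ∧ a.1 m = t) →
    ∃ t : ℝ, 0 ≤ t ∧ lim a = t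

theorem GeneralizedLimit.lim_real (g : GeneralizedLimit) (a : boundedSeq ℂ)
    (ha : ∀ m, ∃ t : ℝ, a.1 m = t) : ∃ t : ℝ, g.lim a = t := by
  obtain ⟨C, hC⟩ := a.2
  let c : boundedSeq ℂ := ⟨fun _ => (C : ℂ), ⟨‖(C : ℂ)‖, fun _ => le_rfl⟩⟩
  have hc : g.lim c = (C : ℂ) := g.lim_eq c _ tendsto_const_nhds
  obtain ⟨t, -, ht⟩ := g.lim_nonneg (a + c) fun m => by
    obtain ⟨s, hs⟩ := ha m
    refine ⟨s + C, ?_, by simp [c, hs]⟩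
    have := hC m
    rw [hs, Complex.norm_real, Real.norm_eq_abs] at this
    linarith [neg_abs_le s]
  refine ⟨t - C, ?_⟩
  rw [map_add, hc] at ht
  rw [Complex.ofReal_sub, ← ht]
  ring

theorem GeneralizedLimit.lim_conj (g : GeneralizedLimit) (a b : boundedSeq ℂ)
    (hab : ∀ m, b.1 m = starRingEnd ℂ (a.1 m)) : g.lim b = starRingEnd ℂ (g.lim a) := by
  obtain ⟨s, hs⟩ := g.lim_real (a + b) fun m => ⟨2 * (a.1 m).re, by
    simp [hab, Complex.add_conj]⟩
  obtain ⟨t, ht⟩ := g.lim_real ((-Complex.I) • (a - b)) fun m => ⟨2 * (a.1 m).im, by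
    simp only [Submodule.coe_smul, Submodule.coe_sub, Pi.smul_apply, Pi.sub_apply, hab,
      smul_eq_mul, Complex.sub_conj]
    linear_combination (-(2 * (a.1 m).im : ℝ) : ℂ) * Complex.I_sq⟩
  rw [map_add] at hs
  rw [map_smul, map_sub, smul_eq_mul] at ht
  have h1 := congrArg Complex.re ht
  have h2 := congrArg Complex.im hs
  have h3 := congrArg Complex.im ht
  simp at h1 h2 h3
  apply Complex.ext <;> simp <;> linarith

variable {H : Type*} [NormedAddCommGroup H] [InnerProductSpace ℂ H]

/-- The bounded scalar sequence `m ↦ ⟨x_m, y_m⟩`. -/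
noncomputable def innerSeq (x y : boundedSeq H) : boundedSeq ℂ :=
  ⟨fun m => inner ℂ (x.1 m) (y.1 m), by
    obtain ⟨C, hC⟩ := x.2
    obtain ⟨D, hD⟩ := y.2
    exact ⟨C * D, fun m => (norm_inner_le_norm _ _).trans
      (mul_le_mul (hC m) (hD m) (norm_nonneg _) ((norm_nonneg _).trans (hC m)))⟩⟩

/-- The space of bounded sequences in `H` with the semi-inner product
`⟨x, y⟩ = lim_m ⟨x_m, y_m⟩` (a type synonym, so that it does not carry the product topology). -/
def PreBerberian (_g : GeneralizedLimit) (H : Type*) [NormedAddCommGroup H]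
    [InnerProductSpace ℂ H] : Type _ :=
  boundedSeq H

namespace PreBerberian

variable (g : GeneralizedLimit)

instance : AddCommGroup (PreBerberian g H) := inferInstanceAs (AddCommGroup (boundedSeq H))

instance : Module ℂ (PreBerberian g H) := inferInstanceAs (Module ℂ (boundedSeq H))

/-- The semi-inner product `⟨x, y⟩ = lim_m ⟨x_m, y_m⟩`. -/
@[reducible]
noncomputable def core : PreInnerProductSpace.Core ℂ (PreBerberian g H) where
  inner x y := g.lim (innerSeq x y)
  conj_inner_symm x y := (g.lim_conj _ _ fun m => by simp [innerSeq]).symm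
  re_inner_nonneg x := by
    obtain ⟨t, ht, h⟩ := g.lim_nonneg (innerSeq x x) fun m =>
      ⟨‖x.1 m‖ ^ 2, by positivity, by simp [innerSeq, inner_self_eq_norm_sq_to_K]⟩
    rw [h]
    simpa using ht
  add_left x y z := by
    rw [← map_add]
    congr 1
    exact Subtype.ext (funext fun m => inner_add_left (x.1 m) (y.1 m) (z.1 m))
  smul_left x y c := by
    rw [← smul_eq_mul, ← map_smul]
    congr 1
    exact Subtype.ext (funext fun m => inner_smul_left (x.1 m) (y.1 m) c)

noncomputable instance : SeminormedAddCommGroup (PreBerberian g H) :=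
  InnerProductSpace.Core.toSeminormedAddCommGroup (𝕜 := ℂ) (c := core g)

noncomputable instance : InnerProductSpace ℂ (PreBerberian g H) :=
  InnerProductSpace.ofCore (core g)

theorem inner_def (x y : PreBerberian g H) : inner ℂ x y = g.lim (innerSeq x y) := rfl

/-- The operator `(x_m) ↦ (T x_m)` on bounded sequences, as a linear map. -/
def mapₗ (T : H →L[ℂ] H) : PreBerberian g H →ₗ[ℂ] PreBerberian g H where
  toFun x := ⟨fun m => T (x.1 m), by
    obtain ⟨C, hC⟩ := x.2
    exact ⟨‖T‖ * C, fun m => (T.le_opNorm _).trans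
      (mul_le_mul_of_nonneg_left (hC m) (norm_nonneg _))⟩⟩
  map_add' x y := Subtype.ext (funext fun m => T.map_add (x.1 m) (y.1 m))
  map_smul' c x := Subtype.ext (funext fun m => T.map_smul c (x.1 m))

theorem norm_mapₗ_le (T : H →L[ℂ] H) (x : PreBerberian g H) :
    ‖mapₗ g T x‖ ≤ ‖T‖ * ‖x‖ := by
  refine le_of_sq_le_sq ?_ (by positivity)
  rw [mul_pow, norm_sq_eq_re_inner (𝕜 := ℂ), norm_sq_eq_re_inner (𝕜 := ℂ) x, inner_def, inner_def]
  obtain ⟨t, ht, h⟩ := g.lim_nonneg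
    (((‖T‖ ^ 2 : ℝ) : ℂ) • innerSeq x x - innerSeq (mapₗ g T x) (mapₗ g T x)) fun m =>
      ⟨‖T‖ ^ 2 * ‖x.1 m‖ ^ 2 - ‖T (x.1 m)‖ ^ 2, by
        rw [← mul_pow, sub_nonneg]
        exact pow_le_pow_left₀ (norm_nonneg _) (T.le_opNorm _) 2, by
        simp only [innerSeq, Submodule.coe_sub, Submodule.coe_smul, Pi.sub_apply, Pi.smul_apply,
          inner_self_eq_norm_sq_to_K, smul_eq_mul]
        push_cast
        rfl⟩
  rw [map_sub, map_smul, smul_eq_mul] at h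
  have := congrArg Complex.re h
  rw [Complex.sub_re, Complex.re_ofReal_mul, Complex.ofReal_re] at this
  simp only [RCLike.re_to_complex]
  linarith

/-- The operator `(x_m) ↦ (T x_m)` on bounded sequences, as a bounded operator. -/
noncomputable def map (T : H →L[ℂ] H) : PreBerberian g H →L[ℂ] PreBerberian g H :=
  (mapₗ g T).mkContinuous ‖T‖ (norm_mapₗ_le g T)

end PreBerberian

/-- The Berberian extension `K` of `H`: bounded sequences modulo those of seminorm zero,
completed. (`UniformSpace.Completion` is the Hausdorff completion.) -/
abbrev BerberianSpace (g : GeneralizedLimit) (H : Type*) [NormedAddCommGroup H]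
    [InnerProductSpace ℂ H] : Type _ :=
  UniformSpace.Completion (PreBerberian g H)

/-- The Berberian representation `T ↦ T°` of `B(H)` on `K`: the bounded operator with
`T° [(x_m)] = [(T x_m)]`. -/
noncomputable def berberianRep (g : GeneralizedLimit) (T : H →L[ℂ] H) :
    BerberianSpace g H →L[ℂ] BerberianSpace g H :=
  (UniformSpace.Completion.toComplL.comp (PreBerberian.map g T)).extend
    UniformSpace.Completion.toComplL

theorem berberianRep_coe (g : GeneralizedLimit) (T : H →L[ℂ] H) (x : PreBerberian g H) :
    berberianRep g T (x : BerberianSpace g H) = (PreBerberian.map g T x : BerberianSpace g H) :=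
  ContinuousLinearMap.extend_eq _ (e := UniformSpace.Completion.toComplL)
    UniformSpace.Completion.denseRange_coe
    (UniformSpace.Completion.isUniformInducing_coe (PreBerberian g H)) x

/-! ### The hypotheses on `T` and `f` -/

variable [CompleteSpace H]

/-- Approximate eigenvectors of `T` are approximate eigenvectors of `T^*`. -/
def ApproxEigenvectorCondition (T : H →L[ℂ] H) : Prop :=
  ∀ (z : ℂ) (x : ℕ → H), (∀ m, ‖x m‖ = 1) →
    Filter.Tendsto (fun m => (T - z • (1 : H →L[ℂ] H)) (x m)) Filter.atTop (nhds 0) →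
    Filter.Tendsto (fun m => ContinuousLinearMap.adjoint (T - z • (1 : H →L[ℂ] H)) (x m))
      Filter.atTop (nhds 0)

/-- If a closed subspace `M` of `K` reduces `T°` and `r e^{iθ} ∈ σ(T°|_M)`, then `M` reduces `U°`
and `|T|°`, and `e^{-iθ} f(r)` is an eigenvalue of `(U°|_M f(|T|°)|_M)^*`. -/
def ReducingCondition (g : GeneralizedLimit) (T U : H →L[ℂ] H) (f : ℝ → ℝ) : Prop :=
  ∀ (M : ClosedSubmodule ℂ (BerberianSpace g H)) (hT : Reduces M (berberianRep g T)) (r θ : ℝ),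
    0 ≤ r → (r : ℂ) * Complex.exp (Complex.I * θ) ∈ spectrum ℂ hT.restrict →
    ∃ (hU : Reduces M (berberianRep g U)) (hP : Reduces M (berberianRep g (CFC.abs T))),
      Complex.exp (-(Complex.I * θ)) * (f r : ℂ) ∈
        pointSpectrum (ContinuousLinearMap.adjoint (hU.restrict * (hP.cfc f).restrict))

end Berberian

/-! The theorem is proved by exchanging `T_j - z_j` for `S_j - w_j`, one index at a time, in a
system of equations `(T_j° - z_j)^* x = 0` in the Berberian space, where `z_j = r_j e^{iθ_j}` and
`w_j = e^{iθ_j} f(r_j)`.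

*Getting the first solution.* For a doubly commuting tuple `A_j = T_j - z_j` the Laplacian of the
Koszul complex is diagonal: on `H ⊗ e_L` it is `∑_{j ∈ L} A_j^* A_j + ∑_{j ∉ L} A_j A_j^*`
(`koszulBoundary_mul_coboundary_add`, by the anticommutation relations of creation and annihilation
operators). It commutes with the boundary map, so the complex is exact as soon as all these blocks
are invertible (`koszulExact_of_bijective_laplacian`). If `z ∈ σ_T(T)`, some block is not bounded
below, which gives unit vectors `x_m` with `A_j x_m → 0` or `A_j^* x_m → 0` for each `j`; by the
approximate eigenvector condition `A_j^* x_m → 0` for all `j`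
(`exists_unit_seq_of_mem_taylorSpectrum`). The class of `(x_m)` is a nonzero solution.

*Exchanging.* The common kernel of the adjoints of the operators with index other than `k` reduces
`T_k°`, and contains a null vector of `(T_k° - z_k)^*`. The reducing condition on this subspace
provides a null vector of `(S_k° - w_k)^*` in it (`ReducingCondition.exists_ne_zero`). After `n`
steps there is `y ≠ 0` with `(S_j° - w_j)^* y = 0` for all `j`.

*Conclusion.* If the Koszul complex of `S - w` were exact at its last place, then `∑ j, (S_j - w_j)
(S_j - w_j)^*` would be invertible, and so would be its image under the Berberian representation,
which annihilates `y`.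

The exchange needs `T_i` and `T_i^*` to commute with `S_j = U_j f(|T_j|)` for `i ≠ j`. As `U_j` is
only assumed unitary, it is arbitrary on `ker T_j` and need not commute with `T_i` there. But if
`ker T_j ≠ 0`, the reducing condition forces `f 0 = 0`
(`ReducingCondition.map_zero_of_apply_eq_zero`), so that the part of `U_j` on `ker T_j` does not
enter into `S_j` (`Commute.mul_cfc_abs`).
-/

/-! ### Creation and annihilation operators -/

section Fermion

variable {V : Type*} [AddCommGroup V] [Module ℂ V] {n : ℕ}

/-- The sign `(-1)^{#{i ∈ L, i < j}}` picked up when `e_j` is moved into its place in `e_L`. -/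
def koszulSign (j : Fin n) (L : Finset (Fin n)) : ℂ := (-1) ^ (L.filter (· < j)).card

theorem koszulSign_mul_self (j : Fin n) (L : Finset (Fin n)) :
    koszulSign j L * koszulSign j L = 1 := by
  rw [koszulSign, ← mul_pow]; norm_num

theorem koszulSign_insert_of_lt {i j : Fin n} (h : i < j) {L : Finset (Fin n)} (hi : i ∉ L) :
    koszulSign j (insert i L) = -koszulSign j L := by
  rw [koszulSign, koszulSign, Finset.filter_insert, if_pos h,
    Finset.card_insert_of_notMem (by simp [hi]), pow_succ]
  ring

theorem koszulSign_insert_of_not_lt {i j : Fin n} (h : ¬ i < j) (L : Finset (Fin n)) :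
    koszulSign j (insert i L) = koszulSign j L := by
  rw [koszulSign, koszulSign, Finset.filter_insert, if_neg h]

theorem koszulSign_insert_self (j : Fin n) (L : Finset (Fin n)) :
    koszulSign j (insert j L) = koszulSign j L :=
  koszulSign_insert_of_not_lt (lt_irrefl j) L

theorem koszulSign_insert_mul {i j : Fin n} (hij : i ≠ j) {L : Finset (Fin n)} (hi : i ∉ L)
    (hj : j ∉ L) :
    koszulSign i L * koszulSign j (insert i L) =
      -(koszulSign j L * koszulSign i (insert j L)) := by
  rcases lt_or_gt_of_ne hij with h | h
  · rw [koszulSign_insert_of_lt h hi, koszulSign_insert_of_not_lt h.not_gt]; ring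
  · rw [koszulSign_insert_of_not_lt h.not_gt, koszulSign_insert_of_lt h hj]; ring

/-- The annihilation operator `c_j` (contraction with `e_j`) on `V ⊗ Λ ℂ^n`, an element of which is
written as a function from the subsets of `Fin n` to `V`. -/
def annihilation (V : Type*) [AddCommGroup V] [Module ℂ V] (j : Fin n) :
    Module.End ℂ (Finset (Fin n) → V) where
  toFun ξ L := if j ∈ L then 0 else koszulSign j L • ξ (insert j L)
  map_add' ξ η := by
    funext L
    by_cases h : j ∈ L <;> simp [h]
  map_smul' c ξ := by
    funext L
    by_cases h : j ∈ L <;> simp [h, smul_comm c]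

/-- The creation operator `c_j^*` (exterior multiplication by `e_j`) on `V ⊗ Λ ℂ^n`. -/
def creation (V : Type*) [AddCommGroup V] [Module ℂ V] (j : Fin n) :
    Module.End ℂ (Finset (Fin n) → V) where
  toFun ξ L := if j ∈ L then koszulSign j L • ξ (L.erase j) else 0
  map_add' ξ η := by
    funext L
    by_cases h : j ∈ L <;> simp [h]
  map_smul' c ξ := by
    funext L
    by_cases h : j ∈ L <;> simp [h, smul_comm c]

theorem annihilation_apply_of_mem {j : Fin n} {L : Finset (Fin n)} (h : j ∈ L)
    (ξ : Finset (Fin n) → V) : annihilation V j ξ L = 0 := if_pos h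

theorem annihilation_apply_of_notMem {j : Fin n} {L : Finset (Fin n)} (h : j ∉ L)
    (ξ : Finset (Fin n) → V) : annihilation V j ξ L = koszulSign j L • ξ (insert j L) := if_neg h

theorem creation_apply_of_mem {j : Fin n} {L : Finset (Fin n)} (h : j ∈ L)
    (ξ : Finset (Fin n) → V) : creation V j ξ L = koszulSign j L • ξ (L.erase j) := if_pos h

theorem creation_apply_of_notMem {j : Fin n} {L : Finset (Fin n)} (h : j ∉ L)
    (ξ : Finset (Fin n) → V) : creation V j ξ L = 0 := if_neg h

theorem annihilation_mul_self (j : Fin n) : annihilation V j * annihilation V j = 0 := by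
  refine LinearMap.ext fun ξ => funext fun L => ?_
  by_cases h : j ∈ L
  · simp [annihilation_apply_of_mem h]
  · simp [annihilation_apply_of_notMem h, annihilation_apply_of_mem (Finset.mem_insert_self j L)]

theorem annihilation_mul_annihilation {i j : Fin n} (hij : i ≠ j) :
    annihilation V i * annihilation V j = -(annihilation V j * annihilation V i) := by
  refine LinearMap.ext fun ξ => funext fun L => ?_
  rw [Module.End.mul_apply, LinearMap.neg_apply, Module.End.mul_apply, Pi.neg_apply]
  by_cases hi : i ∈ L
  · rw [annihilation_apply_of_mem hi]
    by_cases hj : j ∈ L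
    · rw [annihilation_apply_of_mem hj, neg_zero]
    · rw [annihilation_apply_of_notMem hj,
        annihilation_apply_of_mem (Finset.mem_insert_of_mem hi), smul_zero, neg_zero]
  · rw [annihilation_apply_of_notMem hi]
    by_cases hj : j ∈ L
    · rw [annihilation_apply_of_mem hj, annihilation_apply_of_mem (Finset.mem_insert_of_mem hj),
        smul_zero, neg_zero]
    · rw [annihilation_apply_of_notMem hj, annihilation_apply_of_notMem (by simp [hij.symm, hj]),
        annihilation_apply_of_notMem (by simp [hij, hi]), smul_smul, smul_smul, ← neg_smul,
        koszulSign_insert_mul hij hi hj, Finset.insert_comm]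

theorem annihilation_mul_creation {i j : Fin n} (hij : i ≠ j) :
    annihilation V i * creation V j = -(creation V j * annihilation V i) := by
  refine LinearMap.ext fun ξ => funext fun L => ?_
  rw [Module.End.mul_apply, LinearMap.neg_apply, Module.End.mul_apply, Pi.neg_apply]
  by_cases hj : j ∈ L
  · rw [creation_apply_of_mem hj]
    by_cases hi : i ∈ L
    · rw [annihilation_apply_of_mem hi, annihilation_apply_of_mem (by simp [hij, hi]), smul_zero,
        neg_zero]
    · have hi' : i ∉ L.erase j := by simp [hi]
      rw [annihilation_apply_of_notMem hi, annihilation_apply_of_notMem hi',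
        creation_apply_of_mem (Finset.mem_insert_of_mem hj), smul_smul, smul_smul, ← neg_smul,
        Finset.erase_insert_of_ne hij]
      congr 1
      have key := koszulSign_insert_mul hij hi' (Finset.notMem_erase j L)
      have hs : koszulSign j (L.erase j) = koszulSign j L := by
        rw [← koszulSign_insert_self j (L.erase j), Finset.insert_erase hj]
      have hs' : koszulSign j (insert i (L.erase j)) = koszulSign j (insert i L) := by
        rw [← koszulSign_insert_self j, Finset.insert_comm, Finset.insert_erase hj]
      rw [Finset.insert_erase hj, hs, hs'] at key
      -- both signs are their own inverses, so that the identity may be multiplied by them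
      have h1 := koszulSign_mul_self i L
      have h2 := koszulSign_mul_self i (L.erase j)
      linear_combination (koszulSign i L * koszulSign i (L.erase j)) * key
        - koszulSign i L * koszulSign j (insert i L) * h2
        - koszulSign j L * koszulSign i (L.erase j) * h1
  · rw [creation_apply_of_notMem hj]
    by_cases hi : i ∈ L
    · rw [annihilation_apply_of_mem hi, neg_zero]
    · rw [annihilation_apply_of_notMem hi, creation_apply_of_notMem (by simp [hij.symm, hj]),
        smul_zero, neg_zero]

theorem annihilation_mul_creation_self_apply (j : Fin n) (ξ : Finset (Fin n) → V)
    (L : Finset (Fin n)) :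
    (annihilation V j * creation V j) ξ L = if j ∈ L then 0 else ξ L := by
  rw [Module.End.mul_apply]
  split_ifs with h
  · rw [annihilation_apply_of_mem h]
  · rw [annihilation_apply_of_notMem h, creation_apply_of_mem (Finset.mem_insert_self j L),
      koszulSign_insert_self, Finset.erase_insert h, smul_smul, koszulSign_mul_self, one_smul]

theorem creation_mul_annihilation_self_apply (j : Fin n) (ξ : Finset (Fin n) → V)
    (L : Finset (Fin n)) :
    (creation V j * annihilation V j) ξ L = if j ∈ L then ξ L else 0 := by
  rw [Module.End.mul_apply]
  split_ifs with h
  · rw [creation_apply_of_mem h, annihilation_apply_of_notMem (Finset.notMem_erase j L),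
      Finset.insert_erase h, smul_smul]
    have hs : koszulSign j (L.erase j) = koszulSign j L := by
      rw [← koszulSign_insert_self j (L.erase j), Finset.insert_erase h]
    rw [hs, koszulSign_mul_self, one_smul]
  · rw [creation_apply_of_notMem h]

end Fermion

/-! ### The Laplacian of the Koszul complex -/

section Laplacian

variable {H : Type*} [NormedAddCommGroup H] [NormedSpace ℂ H] {n : ℕ}

/-- The operator `A ⊗ 1` on `H ⊗ Λ ℂ^n`. -/
def ampliation (n : ℕ) : (H →L[ℂ] H) →* Module.End ℂ (Finset (Fin n) → H) where
  toFun A := LinearMap.compLeft (A : H →ₗ[ℂ] H) (Finset (Fin n))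
  map_one' := rfl
  map_mul' _ _ := rfl

theorem ampliation_apply (A : H →L[ℂ] H) (ξ : Finset (Fin n) → H) (L : Finset (Fin n)) :
    ampliation n A ξ L = A (ξ L) := rfl

theorem commute_ampliation_annihilation (A : H →L[ℂ] H) (j : Fin n) :
    Commute (ampliation n A) (annihilation H j) := by
  refine LinearMap.ext fun ξ => funext fun L => ?_
  rw [Module.End.mul_apply, Module.End.mul_apply, ampliation_apply]
  by_cases h : j ∈ L
  · simp [annihilation_apply_of_mem h]
  · simp [annihilation_apply_of_notMem h, ampliation_apply]

theorem commute_ampliation_creation (A : H →L[ℂ] H) (j : Fin n) :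
    Commute (ampliation n A) (creation H j) := by
  refine LinearMap.ext fun ξ => funext fun L => ?_
  rw [Module.End.mul_apply, Module.End.mul_apply, ampliation_apply]
  by_cases h : j ∈ L
  · simp [creation_apply_of_mem h, ampliation_apply]
  · simp [creation_apply_of_notMem h]

/-- The Koszul boundary map on all degrees together, `∑ j, A_j ⊗ c_j`. -/
def koszulBoundary (A : Fin n → H →L[ℂ] H) : Module.End ℂ (Finset (Fin n) → H) :=
  ∑ j, ampliation n (A j) * annihilation H j

/-- The coboundary map `∑ j, B_j ⊗ c_j^*`; for `B_j = A_j^*` it is the adjoint of the boundary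
map. -/
def koszulCoboundary (B : Fin n → H →L[ℂ] H) : Module.End ℂ (Finset (Fin n) → H) :=
  ∑ j, ampliation n (B j) * creation H j

theorem koszulBoundary_mul_self {A : Fin n → H →L[ℂ] H} (hA : ∀ i j, Commute (A i) (A j)) :
    koszulBoundary A * koszulBoundary A = 0 := by
  have hterm (i j : Fin n) : (ampliation n (A i) * annihilation H i) *
      (ampliation n (A j) * annihilation H j) =
      -((ampliation n (A j) * annihilation H j) * (ampliation n (A i) * annihilation H i)) := by
    rw [(commute_ampliation_annihilation (A j) i).symm.mul_mul_mul_comm,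
      (commute_ampliation_annihilation (A i) j).symm.mul_mul_mul_comm,
      ← map_mul, ← map_mul, (hA i j).eq]
    rcases eq_or_ne i j with rfl | hij
    · rw [annihilation_mul_self, mul_zero, neg_zero]
    · rw [annihilation_mul_annihilation hij]
      exact LinearMap.comp_neg _ _
  have h : koszulBoundary A * koszulBoundary A = -(koszulBoundary A * koszulBoundary A) := by
    conv_lhs => rw [koszulBoundary, Finset.sum_mul_sum]
    conv_rhs => rw [koszulBoundary, Finset.sum_mul_sum, Finset.sum_comm]
    simp_rw [← Finset.sum_neg_distrib]
    exact Finset.sum_congr rfl fun i _ => Finset.sum_congr rfl fun j _ => hterm i j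
  refine LinearMap.ext fun ξ => funext fun L => ?_
  have h2 := add_eq_zero_iff_eq_neg.mpr (congrFun (LinearMap.congr_fun h ξ) L)
  rw [← two_smul ℂ] at h2
  exact (smul_eq_zero_iff_right two_ne_zero).mp h2

/-- The diagonal blocks of the Koszul Laplacian: on `H ⊗ e_L` it acts as
`∑_{j ∈ L} B_j A_j + ∑_{j ∉ L} A_j B_j`. -/
def koszulLaplacian (A B : Fin n → H →L[ℂ] H) (L : Finset (Fin n)) : H →L[ℂ] H :=
  ∑ j, if j ∈ L then B j * A j else A j * B j

/-- If `A_i` commutes with `B_j` for `i ≠ j`, the Laplacian of the Koszul complex has no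
off-diagonal part: the cross terms cancel by the anticommutation relations. -/
theorem koszulBoundary_mul_coboundary_add {A B : Fin n → H →L[ℂ] H}
    (hAB : ∀ i j, i ≠ j → Commute (A i) (B j)) (ξ : Finset (Fin n) → H) (L : Finset (Fin n)) :
    (koszulBoundary A * koszulCoboundary B + koszulCoboundary B * koszulBoundary A) ξ L =
      koszulLaplacian A B L (ξ L) := by
  have hterm (i j : Fin n) : (ampliation n (A i) * annihilation H i) *
      (ampliation n (B j) * creation H j) +
      (ampliation n (B j) * creation H j) * (ampliation n (A i) * annihilation H i) =
      if i = j then ampliation n (A i * B i) * (annihilation H i * creation H i) +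
        ampliation n (B i * A i) * (creation H i * annihilation H i) else 0 := by
    rw [(commute_ampliation_annihilation (B j) i).symm.mul_mul_mul_comm,
      (commute_ampliation_creation (A i) j).symm.mul_mul_mul_comm,
      ← map_mul, ← map_mul]
    split_ifs with hij
    · rw [hij]
    · rw [annihilation_mul_creation hij, (hAB i j hij).eq]
      exact add_eq_zero_iff_eq_neg.mpr (LinearMap.comp_neg _ _)
  have hsum : koszulBoundary A * koszulCoboundary B + koszulCoboundary B * koszulBoundary A =
      ∑ i, (ampliation n (A i * B i) * (annihilation H i * creation H i) +
        ampliation n (B i * A i) * (creation H i * annihilation H i)) := by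
    rw [koszulBoundary, koszulCoboundary, Finset.sum_mul_sum, Finset.sum_mul_sum]
    rw [Finset.sum_comm (f := fun i j => ampliation n (B i) * creation H i *
      (ampliation n (A j) * annihilation H j)), ← Finset.sum_add_distrib]
    refine Finset.sum_congr rfl fun i _ => ?_
    rw [← Finset.sum_add_distrib, Finset.sum_congr rfl fun j _ => hterm i j]
    simp
  rw [hsum, koszulLaplacian, LinearMap.sum_apply, Finset.sum_apply, sum_apply]
  refine Finset.sum_congr rfl fun j _ => ?_
  rw [LinearMap.add_apply, Pi.add_apply, Module.End.mul_apply, ampliation_apply,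
    Module.End.mul_apply (ampliation n (B j * A j)), ampliation_apply,
    annihilation_mul_creation_self_apply, creation_mul_annihilation_self_apply]
  split_ifs <;> simp

/-- The degree-`k` part of an element of `H ⊗ Λ ℂ^n`. -/
def koszulRestrict {n : ℕ} (k : ℕ) (ξ : Finset (Fin n) → H) : KoszulSpace n H k := fun L => ξ L.1

/-- The element of `H ⊗ Λ ℂ^n` with the given part in degree `k` and no other part. -/
def koszulExtend {n k : ℕ} (ξ : KoszulSpace n H k) : Finset (Fin n) → H :=
  fun L => if h : L.card = k then ξ ⟨L, h⟩ else 0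

omit [NormedSpace ℂ H] in
theorem koszulRestrict_koszulExtend {k : ℕ} (ξ : KoszulSpace n H k) :
    koszulRestrict k (koszulExtend ξ) = ξ := by
  funext L
  simp [koszulRestrict, koszulExtend, L.2]

theorem koszulBoundary_apply (A : Fin n → H →L[ℂ] H) (ξ : Finset (Fin n) → H)
    (L : Finset (Fin n)) :
    koszulBoundary A ξ L = ∑ j : {j // j ∉ L}, koszulSign j.1 L • A j (ξ (insert j.1 L)) := by
  rw [koszulBoundary, LinearMap.sum_apply, Finset.sum_apply,
    ← Finset.sum_subtype (p := fun j => j ∉ L) (Finset.univ.filter (· ∉ L)) (by simp)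
      (fun j => koszulSign j L • A j (ξ (insert j L))), Finset.sum_filter]
  refine Finset.sum_congr rfl fun j _ => ?_
  rw [Module.End.mul_apply, ampliation_apply]
  by_cases h : j ∈ L
  · rw [annihilation_apply_of_mem h, map_zero, if_neg (not_not.mpr h)]
  · rw [annihilation_apply_of_notMem h, map_smul, if_pos h]

theorem koszulD_koszulRestrict (A : Fin n → H →L[ℂ] H) (k : ℕ) (ξ : Finset (Fin n) → H) :
    koszulD A k (koszulRestrict (k + 1) ξ) = koszulRestrict k (koszulBoundary A ξ) := by
  funext L
  rw [koszulRestrict, koszulBoundary_apply]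
  rfl

theorem koszulBoundary_koszulExtend_apply (A : Fin n → H →L[ℂ] H) {k : ℕ}
    (ξ : KoszulSpace n H (k + 1)) :
    koszulBoundary A (koszulExtend ξ) = koszulExtend (koszulD A k ξ) := by
  funext L
  by_cases h : L.card = k
  · conv_rhs => rw [← koszulRestrict_koszulExtend ξ, koszulD_koszulRestrict]
    simp [koszulExtend, h, koszulRestrict]
  · rw [koszulBoundary_apply]
    simp only [koszulExtend, h, dif_neg, not_false_eq_true]
    refine Finset.sum_eq_zero fun j _ => ?_
    rw [dif_neg, map_zero, smul_zero]
    rw [Finset.card_insert_of_notMem j.2]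
    omega

/-- The Koszul complex is exact if the diagonal blocks of its Laplacian are bijective: the
coboundary map, composed with the inverse of the Laplacian, is a contracting homotopy. -/
theorem koszulExact_of_bijective_laplacian {A B : Fin n → H →L[ℂ] H}
    (hA : ∀ i j, Commute (A i) (A j)) (hAB : ∀ i j, i ≠ j → Commute (A i) (B j))
    (hL : ∀ L, Function.Bijective (koszulLaplacian A B L)) : KoszulExact A := by
  set D := koszulBoundary A
  set δ := koszulCoboundary B
  have hDD : D * D = 0 := koszulBoundary_mul_self hA
  set Λ := D * δ + δ * D with hΛ
  have hΛapply (ξ : Finset (Fin n) → H) (L) : Λ ξ L = koszulLaplacian A B L (ξ L) :=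
    koszulBoundary_mul_coboundary_add hAB ξ L
  have hΛinj : Function.Injective Λ := fun ξ η h => funext fun L =>
    (hL L).1 (by rw [← hΛapply, ← hΛapply, h])
  have hcomm : D * Λ = Λ * D := by
    rw [hΛ, mul_add, add_mul, ← mul_assoc, hDD, ← mul_assoc, mul_assoc δ D D, hDD]
    simp
  have hsolve (ξ : Finset (Fin n) → H) : ∃ η, Λ η = ξ := by
    choose η hη using fun L => (hL L).2 (ξ L)
    exact ⟨η, funext fun L => by rw [hΛapply, hη]⟩
  have hexact (ξ : Finset (Fin n) → H) (hξ : D ξ = 0) : ∃ η, D η = ξ := by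
    obtain ⟨η, rfl⟩ := hsolve ξ
    have hη : D η = 0 := hΛinj <| by
      rw [map_zero, ← Module.End.mul_apply, ← hcomm, Module.End.mul_apply, hξ]
    exact ⟨δ η, by simp [hΛ, hη]⟩
  refine ⟨fun ξ => ?_, fun k ξ => ⟨fun hξ => ?_, ?_⟩⟩
  · -- `D` vanishes in degree `0`
    obtain ⟨η, hη⟩ := hexact (koszulExtend ξ) <| by
      funext L
      rw [koszulBoundary_apply]
      refine Finset.sum_eq_zero fun j _ => ?_
      simp [koszulExtend, (Finset.insert_nonempty j.1 L).ne_empty]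
    exact ⟨koszulRestrict 1 η, by
      rw [koszulD_koszulRestrict, hη, koszulRestrict_koszulExtend]⟩
  · obtain ⟨η, hη⟩ := hexact (koszulExtend ξ) <| by
      rw [koszulBoundary_koszulExtend_apply, hξ]
      funext L
      simp [koszulExtend]
    exact ⟨koszulRestrict (k + 2) η, by
      rw [koszulD_koszulRestrict, hη, koszulRestrict_koszulExtend]⟩
  · rintro ⟨η, rfl⟩
    rw [← koszulRestrict_koszulExtend η, koszulD_koszulRestrict, koszulD_koszulRestrict,
      ← Module.End.mul_apply, hDD]
    rfl

end Laplacian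

/-! ### The Taylor spectrum and joint approximate eigenvectors -/

section JointSpectrum

open Filter Topology
open scoped ContinuousLinearMap InnerProduct

variable {H : Type*} [NormedAddCommGroup H] [InnerProductSpace ℂ H] {n : ℕ}

theorem exists_unit_seq_of_not_bddBelow (E : Fin n → H →L[ℂ] H)
    (h : ¬ ∃ c : ℝ, 0 < c ∧ ∀ x, c * ‖x‖ ^ 2 ≤ ∑ j, ‖E j x‖ ^ 2) :
    ∃ x : ℕ → H, (∀ m, ‖x m‖ = 1) ∧ ∀ j, Tendsto (fun m => E j (x m)) atTop (𝓝 0) := by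
  push Not at h
  have hstep (m : ℕ) : ∃ x : H, ‖x‖ = 1 ∧ ∀ j, ‖E j x‖ ^ 2 ≤ 1 / ((m : ℝ) + 1) := by
    obtain ⟨y, hy⟩ := h (1 / ((m : ℝ) + 1)) (by positivity)
    have hy0 : y ≠ 0 := by
      rintro rfl
      simp at hy
    have hn : 0 < ‖y‖ := norm_pos_iff.mpr hy0
    refine ⟨((‖y‖⁻¹ : ℝ) : ℂ) • y, by simp [norm_smul, hn.ne'], fun j => ?_⟩
    have hj : ‖E j y‖ ^ 2 ≤ ∑ j, ‖E j y‖ ^ 2 :=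
      Finset.single_le_sum (f := fun j => ‖E j y‖ ^ 2) (fun i _ => by positivity)
        (Finset.mem_univ j)
    rw [map_smul, norm_smul, mul_pow, Complex.norm_real, norm_inv, norm_norm, inv_pow,
      inv_mul_le_iff₀ (by positivity), mul_comm]
    exact hj.trans hy.le
  choose x hx1 hx using hstep
  refine ⟨x, hx1, fun j => ?_⟩
  rw [tendsto_zero_iff_norm_tendsto_zero]
  have h2 : Tendsto (fun m => ‖E j (x m)‖ ^ 2) atTop (𝓝 0) :=
    squeeze_zero (fun m => by positivity) (fun m => hx m j) tendsto_one_div_add_atTop_nhds_zero_nat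
  simpa using h2.sqrt

variable [CompleteSpace H]

theorem isUnit_sum_adjoint_mul_self {E : Fin n → H →L[ℂ] H} {c : ℝ} (hc : 0 < c)
    (h : ∀ x, c * ‖x‖ ^ 2 ≤ ∑ j, ‖E j x‖ ^ 2) :
    IsUnit (∑ j, ContinuousLinearMap.adjoint (E j) * E j) := by
  refine ContinuousLinearMap.isUnit_of_forall_le_norm_inner_map _ (c := ⟨c, hc.le⟩) hc fun x => ?_
  have hinner : inner ℂ ((∑ j, ContinuousLinearMap.adjoint (E j) * E j) x) x =
      ((∑ j, ‖E j x‖ ^ 2 : ℝ) : ℂ) := by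
    rw [sum_apply, sum_inner]
    push_cast
    refine Finset.sum_congr rfl fun j _ => ?_
    rw [Function.comp_apply, ContinuousLinearMap.adjoint_inner_left,
      inner_self_eq_norm_sq_to_K]
    rfl
  rw [hinner, Complex.norm_real, Real.norm_of_nonneg (Finset.sum_nonneg fun j _ => by positivity),
    mul_comm]
  exact h x

/-- Under the approximate eigenvector condition the Taylor spectrum of a doubly commuting tuple
consists of joint approximate eigenvalues of the adjoints: a degenerate block of the Koszul
Laplacian gives unit vectors on which each `A_j = T_j - z_j` or its adjoint tends to zero, and
in the former case the adjoint does so too. -/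
theorem exists_unit_seq_of_mem_taylorSpectrum {T : Fin n → H →L[ℂ] H} (hT : DoublyCommuting T)
    (h1 : ∀ j, ApproxEigenvectorCondition (T j)) {z : Fin n → ℂ} (hz : z ∈ taylorSpectrum T) :
    ∃ x : ℕ → H, (∀ m, ‖x m‖ = 1) ∧ ∀ j, Tendsto
      (fun m => ContinuousLinearMap.adjoint (T j - z j • (1 : H →L[ℂ] H)) (x m)) atTop (𝓝 0) := by
  by_contra hcon
  refine hz ?_
  have hscalar (w : ℂ) (B : H →L[ℂ] H) : Commute (w • (1 : H →L[ℂ] H)) B :=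
    (Commute.one_left B).smul_left w
  refine koszulExact_of_bijective_laplacian
    (B := fun j => ContinuousLinearMap.adjoint (T j - z j • (1 : H →L[ℂ] H)))
    (fun i j => ?_) (fun i j hij => ?_) fun L => ?_
  · rcases eq_or_ne i j with rfl | hij
    · exact Commute.refl _
    · exact ((hT i j hij).1.sub_left (hscalar _ _)).sub_right
        ((hscalar _ _).symm)
  · rw [← ContinuousLinearMap.star_eq_adjoint, star_sub, star_smul, star_one]
    exact ((hT i j hij).2.sub_left (hscalar _ _)).sub_right ((hscalar _ _).symm)
  · set E : Fin n → H →L[ℂ] H := fun j => if j ∈ L then T j - z j • (1 : H →L[ℂ] H) else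
      ContinuousLinearMap.adjoint (T j - z j • (1 : H →L[ℂ] H)) with hE
    have hbdd : ∃ c : ℝ, 0 < c ∧ ∀ x, c * ‖x‖ ^ 2 ≤ ∑ j, ‖E j x‖ ^ 2 := by
      by_contra hb
      obtain ⟨x, hx1, hx⟩ := exists_unit_seq_of_not_bddBelow E hb
      refine hcon ⟨x, hx1, fun j => ?_⟩
      specialize hx j
      by_cases hj : j ∈ L
      · simp only [hE, if_pos hj] at hx
        exact h1 j _ x hx1 hx
      · simpa only [hE, if_neg hj] using hx
    obtain ⟨c, hc, hbd⟩ := hbdd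
    have hunit := isUnit_sum_adjoint_mul_self hc hbd
    rw [ContinuousLinearMap.isUnit_iff_bijective] at hunit
    convert hunit using 2
    rw [koszulLaplacian]
    refine Finset.sum_congr rfl fun j _ => ?_
    by_cases hj : j ∈ L <;> simp [hE, hj]

/-- If the last map of the Koszul complex is onto, then `∑ j, A_j A_j^*` is invertible. -/
theorem isUnit_sum_mul_adjoint_of_surjective {A : Fin n → H →L[ℂ] H}
    (hA : Function.Surjective (koszulD A 0)) :
    IsUnit (∑ j, A j * ContinuousLinearMap.adjoint (A j)) := by
  let Φ : (Fin n → H) →L[ℂ] H := ∑ j, (A j).comp (ContinuousLinearMap.proj j)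
  have hΦ (h : Fin n → H) : Φ h = ∑ j, A j (h j) := by simp [Φ]
  have hsurj : Function.Surjective Φ := fun y => by
    obtain ⟨ξ, hξ⟩ := hA fun _ => y
    have hy : y = koszulBoundary A (koszulExtend ξ) ∅ := by
      rw [koszulBoundary_koszulExtend_apply, hξ]
      simp [koszulExtend]
    refine ⟨fun j => koszulExtend ξ {j}, ?_⟩
    rw [hΦ, hy, koszulBoundary_apply]
    rw [← Finset.sum_subtype (p := fun j => j ∉ (∅ : Finset (Fin n))) Finset.univ (by simp)
      (fun j => koszulSign j ∅ • A j (koszulExtend ξ (insert j ∅)))]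
    simp [koszulSign]
  obtain ⟨C, hC, hpre⟩ := Φ.exists_preimage_norm_le hsurj
  have hbound (x : H) : ‖x‖ ≤ C * ∑ j, ‖ContinuousLinearMap.adjoint (A j) x‖ := by
    rcases eq_or_ne x 0 with rfl | hx
    · simp
    obtain ⟨h, hh, hnorm⟩ := hpre x
    have hsq : ‖x‖ * ‖x‖ ≤ ‖x‖ * (C * ∑ j, ‖ContinuousLinearMap.adjoint (A j) x‖) := by
      calc ‖x‖ * ‖x‖ = ‖inner ℂ (∑ j, A j (h j)) x‖ := by
            rw [← hΦ, hh, inner_self_eq_norm_sq_to_K]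
            simp [sq]
        _ ≤ ∑ j, ‖inner ℂ (A j (h j)) x‖ := by
            rw [sum_inner]
            exact norm_sum_le _ _
        _ ≤ ∑ j, (C * ‖x‖) * ‖ContinuousLinearMap.adjoint (A j) x‖ := by
            refine Finset.sum_le_sum fun j _ => ?_
            rw [← ContinuousLinearMap.adjoint_inner_right]
            exact (norm_inner_le_norm _ _).trans (mul_le_mul_of_nonneg_right
              ((norm_le_pi_norm h j).trans hnorm) (norm_nonneg _))
        _ = _ := by rw [← Finset.mul_sum]; ring
    exact le_of_mul_le_mul_left hsq (norm_pos_iff.mpr hx)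
  have hsum : ∃ c : ℝ, 0 < c ∧ ∀ x,
      c * ‖x‖ ^ 2 ≤ ∑ j, ‖ContinuousLinearMap.adjoint (A j) x‖ ^ 2 := by
    by_contra hb
    obtain ⟨x, hx1, hx⟩ :=
      exists_unit_seq_of_not_bddBelow (fun j => ContinuousLinearMap.adjoint (A j)) hb
    have hlim : Tendsto (fun m => C * ∑ j, ‖ContinuousLinearMap.adjoint (A j) (x m)‖) atTop
        (𝓝 (C * ∑ j : Fin n, 0)) :=
      (tendsto_finsetSum _ fun j _ => by simpa using (hx j).norm).const_mul C
    rw [Finset.sum_const_zero, mul_zero] at hlim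
    have := le_of_tendsto_of_tendsto' (tendsto_const_nhds (x := (1 : ℝ))) hlim
      fun m => (hx1 m) ▸ hbound (x m)
    linarith
  obtain ⟨c, hc, hcb⟩ := hsum
  simpa using isUnit_sum_adjoint_mul_self hc hcb

end JointSpectrum

/-! ### The Berberian representation -/

section BerberianRepresentation

open Filter Topology UniformSpace

variable {H : Type*} [NormedAddCommGroup H] [InnerProductSpace ℂ H] (g : GeneralizedLimit)

theorem berberianSpace_clm_ext {A B : BerberianSpace g H →L[ℂ] BerberianSpace g H}
    (h : ∀ x : PreBerberian g H, A x = B x) : A = B :=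
  ContinuousLinearMap.ext fun x => congrFun
    (Completion.ext A.continuous B.continuous h) x

theorem berberianRep_add (A B : H →L[ℂ] H) :
    berberianRep g (A + B) = berberianRep g A + berberianRep g B := by
  refine berberianSpace_clm_ext g fun x => ?_
  rw [_root_.add_apply, berberianRep_coe, berberianRep_coe, berberianRep_coe,
    ← Completion.coe_add]
  rfl

theorem berberianRep_smul (c : ℂ) (A : H →L[ℂ] H) :
    berberianRep g (c • A) = c • berberianRep g A := by
  refine berberianSpace_clm_ext g fun x => ?_
  rw [_root_.smul_apply, berberianRep_coe, berberianRep_coe, ← Completion.coe_smul]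
  rfl

theorem berberianRep_one : berberianRep g (1 : H →L[ℂ] H) = 1 := by
  refine berberianSpace_clm_ext g fun x => ?_
  rw [berberianRep_coe]
  rfl

theorem berberianRep_mul (A B : H →L[ℂ] H) :
    berberianRep g (A * B) = berberianRep g A * berberianRep g B := by
  refine berberianSpace_clm_ext g fun x => ?_
  rw [mul_apply_eq_comp, berberianRep_coe, berberianRep_coe, berberianRep_coe]
  rfl

theorem berberianRep_adjoint [CompleteSpace H] (A : H →L[ℂ] H) :
    berberianRep g (ContinuousLinearMap.adjoint A) =
      ContinuousLinearMap.adjoint (berberianRep g A) := by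
  rw [ContinuousLinearMap.eq_adjoint_iff]
  intro x y
  induction x, y using Completion.induction_on₂ with
  | hp => exact isClosed_eq (by fun_prop) (by fun_prop)
  | ih x y =>
    rw [berberianRep_coe, berberianRep_coe, Completion.inner_coe, Completion.inner_coe,
      PreBerberian.inner_def, PreBerberian.inner_def]
    congr 1
    exact Subtype.ext (funext fun m => ContinuousLinearMap.adjoint_inner_left A _ _)

/-- The Berberian representation as a unital `*`-homomorphism. -/
noncomputable def berberianStarAlgHom [CompleteSpace H] :
    (H →L[ℂ] H) →⋆ₐ[ℂ] (BerberianSpace g H →L[ℂ] BerberianSpace g H) where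
  toFun := berberianRep g
  map_one' := berberianRep_one g
  map_mul' := berberianRep_mul g
  map_zero' := by simpa using berberianRep_smul g 0 (0 : H →L[ℂ] H)
  map_add' := berberianRep_add g
  commutes' c := by
    rw [Algebra.algebraMap_eq_smul_one, Algebra.algebraMap_eq_smul_one, berberianRep_smul,
      berberianRep_one]
  map_star' A := berberianRep_adjoint g A

theorem berberianStarAlgHom_apply [CompleteSpace H] (A : H →L[ℂ] H) :
    berberianStarAlgHom g A = berberianRep g A := rfl

theorem berberianRep_cfc [CompleteSpace H] {A : H →L[ℂ] H} (hA : IsSelfAdjoint A) {f : ℝ → ℝ}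
    (hf : ContinuousOn f (spectrum ℝ A)) :
    berberianRep g (cfc f A) = cfc f (berberianRep g A) :=
  StarAlgHomClass.map_cfc (S := ℂ) (berberianStarAlgHom g) f A hf
    (map_continuous (berberianStarAlgHom g)) hA (hA.map (berberianStarAlgHom g))

/-- A sequence of unit vectors gives a unit vector of the Berberian space, and any operator that
tends to zero along the sequence annihilates it. -/
theorem exists_ne_zero_berberianRep_eq_zero {x : ℕ → H} (hx : ∀ m, ‖x m‖ = 1) :
    ∃ y : BerberianSpace g H, y ≠ 0 ∧ ∀ A : H →L[ℂ] H,
      Tendsto (fun m => A (x m)) atTop (𝓝 0) → berberianRep g A y = 0 := by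
  let X : PreBerberian g H := ⟨x, 1, fun m => (hx m).le⟩
  have hnorm (Y : PreBerberian g H) {l : ℝ} (hY : Tendsto (fun m => ‖Y.1 m‖) atTop (𝓝 l)) :
      ((‖Y‖ ^ 2 : ℝ) : ℂ) = ((l ^ 2 : ℝ) : ℂ) := by
    have h := g.lim_eq (innerSeq Y Y) ((l ^ 2 : ℝ) : ℂ) <| by
      have h' : (innerSeq Y Y).1 = fun m => ((‖Y.1 m‖ ^ 2 : ℝ) : ℂ) := by
        funext m
        simp [innerSeq, inner_self_eq_norm_sq_to_K]
      rw [h']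
      exact (Complex.continuous_ofReal.tendsto _).comp (hY.pow 2)
    rw [← PreBerberian.inner_def, inner_self_eq_norm_sq_to_K] at h
    rw [← h]
    push_cast
    rfl
  refine ⟨(X : BerberianSpace g H), fun h0 => ?_, fun A hA => ?_⟩
  · have h1 := hnorm X (l := 1) (by simp [X, hx])
    rw [← Completion.norm_coe, h0] at h1
    norm_num at h1
  · have hA0 : Tendsto (fun m => ‖A (x m)‖) atTop (𝓝 0) := by simpa using hA.norm
    have h1 := hnorm (PreBerberian.map g A X) hA0
    rw [berberianRep_coe, ← norm_eq_zero, Completion.norm_coe]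
    have h2 := Complex.ofReal_injective h1
    simpa using h2

end BerberianRepresentation

/-! ### Operators commuting with `U f(|T|)` -/

section PolarDecomposition

open Filter Topology

variable {H : Type*} [NormedAddCommGroup H] [InnerProductSpace ℂ H] [CompleteSpace H]

theorem norm_abs_apply (T : H →L[ℂ] H) (x : H) : ‖CFC.abs T x‖ = ‖T x‖ := by
  have hinner : inner ℂ (CFC.abs T x) (CFC.abs T x) = inner ℂ (T x) (T x) := by
    have hself : ContinuousLinearMap.adjoint (CFC.abs T) = CFC.abs T :=
      (CFC.abs_nonneg T).isSelfAdjoint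
    rw [← ContinuousLinearMap.adjoint_inner_left (CFC.abs T), hself,
      ← ContinuousLinearMap.adjoint_inner_left T]
    exact congrArg (fun B : H →L[ℂ] H => inner ℂ (B x) x) (CFC.abs_mul_abs T)
  rw [inner_self_eq_norm_sq_to_K, inner_self_eq_norm_sq_to_K] at hinner
  have h2 : ‖CFC.abs T x‖ ^ 2 = ‖T x‖ ^ 2 := by exact_mod_cast hinner
  exact (pow_left_inj₀ (norm_nonneg _) (norm_nonneg _) two_ne_zero).mp h2

/-- If `f 0 = 0`, then `f(P)` annihilates whatever `P` annihilates. -/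
theorem cfc_mul_eq_zero {P C : H →L[ℂ] H} (hP : IsSelfAdjoint P) (hPC : P * C = 0) {f : ℝ → ℝ}
    (hf : ContinuousOn f (spectrum ℝ P)) (h0 : (0 : ℝ) ∈ spectrum ℝ P) (hf0 : f 0 = 0) :
    cfc f P * C = 0 := by
  have hq : quasispectrum ℝ P = spectrum ℝ P := by
    rw [quasispectrum_eq_spectrum_union_zero]
    simpa using h0
  have hf' : ContinuousOn f (quasispectrum ℝ P) := hq ▸ hf
  rw [← cfcₙ_eq_cfc hf' hf0, cfcₙ_apply f P hf' hf0 hP]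
  refine ContinuousMapZero.nonUnitalStarAlgHom_apply_mul_eq_zero _ C ?_ ?_
    (cfcₙHom_continuous hP) _
  · rwa [cfcₙHom_id hP]
  · rwa [map_star, cfcₙHom_id hP, hP.star_eq]

/-- Let `T = U |T|`, where `f 0 = 0` unless `T` is injective. Then `U f(|T|)` commutes with every
operator that commutes with `T` and `T^*`. The commutator `C` of such an operator with `U` need not
vanish, as `U` is arbitrary on `ker T`, but `C |T| = 0`. -/
theorem Commute.mul_cfc_abs {B T U : H →L[ℂ] H} (hpolar : T = U * CFC.abs T) {f : ℝ → ℝ}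
    (hf : ContinuousOn f (spectrum ℝ (CFC.abs T))) (hf0 : ∀ v, v ≠ 0 → T v = 0 → f 0 = 0)
    (hB : Commute B T) (hB' : Commute B (ContinuousLinearMap.adjoint T)) :
    Commute B (U * cfc f (CFC.abs T)) := by
  set P := CFC.abs T with hPdef
  have hPs : IsSelfAdjoint P := (CFC.abs_nonneg T).isSelfAdjoint
  have hBP : Commute B P := Commute.cfcAbs_right hB.symm <| by
    have := hB'.star_star
    rw [← ContinuousLinearMap.star_eq_adjoint, _root_.star_star] at this
    exact this.symm
  have hCP : (B * U - U * B) * P = 0 := by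
    rw [sub_mul, mul_assoc, mul_assoc, hBP.eq, ← mul_assoc U P B, ← hpolar, hB.eq, sub_self]
  have hPC : P * star (B * U - U * B) = 0 := by
    have := congrArg star hCP
    rwa [star_mul, hPs.star_eq, star_zero] at this
  have hfC : cfc f P * star (B * U - U * B) = 0 := by
    by_cases hker : ∃ v, v ≠ 0 ∧ T v = 0
    · obtain ⟨v, hv, hTv⟩ := hker
      refine cfc_mul_eq_zero hPs hPC hf ?_ (hf0 v hv hTv)
      rw [spectrum.zero_mem_iff]
      intro hunit
      have hPv : P v = 0 := by rw [← norm_eq_zero, norm_abs_apply, hTv, norm_zero]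
      exact hv ((ContinuousLinearMap.isUnit_iff_bijective.mp hunit).1 (by rw [hPv, map_zero]))
    · push Not at hker
      have hC : star (B * U - U * B) = 0 := by
        refine ContinuousLinearMap.ext fun x => ?_
        by_contra hx
        refine hker _ hx ?_
        rw [← norm_eq_zero, ← norm_abs_apply]
        exact norm_eq_zero.mpr (congrArg (fun A : H →L[ℂ] H => A x) hPC)
      rw [hC, mul_zero]
  have hCf : (B * U - U * B) * cfc f P = 0 := by
    have := congrArg star hfC
    rwa [star_mul, (cfc_predicate f P : IsSelfAdjoint (cfc f P)).star_eq, _root_.star_star,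
      star_zero] at this
  rw [sub_mul, sub_eq_zero] at hCf
  rw [commute_iff_eq, ← mul_assoc, hCf, mul_assoc, mul_assoc, (hBP.symm.cfc_real f).eq]

end PolarDecomposition

/-! ### Reducing subspaces -/

section Reducing

open Filter Topology

variable {K : Type*} [NormedAddCommGroup K] [InnerProductSpace ℂ K] [CompleteSpace K]

theorem Reduces.coe_restrict {M : ClosedSubmodule ℂ K} {A : K →L[ℂ] K} (h : Reduces M A)
    (x : M.toSubmodule) : (h.restrict x : K) = A x := rfl

theorem Reduces.coe_adjoint_restrict {M : ClosedSubmodule ℂ K} {A : K →L[ℂ] K} (h : Reduces M A)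
    (x : M.toSubmodule) :
    (ContinuousLinearMap.adjoint h.restrict x : K) = ContinuousLinearMap.adjoint A x := by
  have key : ContinuousLinearMap.adjoint h.restrict x =
      ⟨ContinuousLinearMap.adjoint A x, h.2 x x.2⟩ := by
    refine ext_inner_right ℂ fun y => ?_
    rw [ContinuousLinearMap.adjoint_inner_left, Submodule.coe_inner, Submodule.coe_inner,
      h.coe_restrict, ContinuousLinearMap.adjoint_inner_left]
  rw [key]

theorem Reduces.mem_spectrum_restrict {M : ClosedSubmodule ℂ K} {A : K →L[ℂ] K} (h : Reduces M A)
    {z : ℂ} {x : K} (hxM : x ∈ M.toSubmodule) (hx : x ≠ 0)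
    (hAx : ContinuousLinearMap.adjoint (A - z • (1 : K →L[ℂ] K)) x = 0) :
    z ∈ spectrum ℂ h.restrict := by
  intro hunit
  have hstar := hunit.star
  rw [ContinuousLinearMap.star_eq_adjoint, ContinuousLinearMap.isUnit_iff_bijective] at hstar
  have h0 : ContinuousLinearMap.adjoint
      (algebraMap ℂ (M.toSubmodule →L[ℂ] M.toSubmodule) z - h.restrict) ⟨x, hxM⟩ = 0 := by
    rw [Algebra.algebraMap_eq_smul_one, ← ContinuousLinearMap.star_eq_adjoint, star_sub, star_smul,
      star_one]
    apply Subtype.ext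
    rw [← ContinuousLinearMap.star_eq_adjoint, star_sub, star_smul, star_one] at hAx
    have hAx' : ContinuousLinearMap.adjoint A x = star z • x := sub_eq_zero.mp hAx
    change star z • x - (ContinuousLinearMap.adjoint h.restrict ⟨x, hxM⟩ : K) = 0
    rw [h.coe_adjoint_restrict, hAx', sub_self]
  have hx0 := hstar.1 (h0.trans (map_zero _).symm)
  exact hx (congrArg Subtype.val hx0)

/-- The common kernel of the adjoints of finitely many operators. -/
noncomputable def jointCokernel {ι : Type*} (A : ι → K →L[ℂ] K) : ClosedSubmodule ℂ K :=
  ⨅ i, (⊥ : ClosedSubmodule ℂ K).comap (ContinuousLinearMap.adjoint (A i))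

theorem mem_jointCokernel {ι : Type*} {A : ι → K →L[ℂ] K} {x : K} :
    x ∈ (jointCokernel A).toSubmodule ↔ ∀ i, ContinuousLinearMap.adjoint (A i) x = 0 := by
  rw [ClosedSubmodule.mem_toSubmodule_iff, jointCokernel, ClosedSubmodule.mem_iInf]
  rfl

theorem reduces_jointCokernel {ι : Type*} {A : ι → K →L[ℂ] K} {B : K →L[ℂ] K}
    (h : ∀ i, Commute B (A i)) (h' : ∀ i, Commute B (ContinuousLinearMap.adjoint (A i))) :
    Reduces (jointCokernel A) B := by
  refine ⟨fun x hx => ?_, fun x hx => ?_⟩ <;> rw [mem_jointCokernel] at hx ⊢ <;> intro i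
  · have := congrArg (fun C : K →L[ℂ] K => C x) (h' i).eq
    exact this.symm.trans ((congrArg B (hx i)).trans (map_zero B))
  · have := congrArg (fun C : K →L[ℂ] K => C x) (h i).star_star.eq
    exact this.symm.trans ((congrArg (ContinuousLinearMap.adjoint B) (hx i)).trans
      (map_zero (ContinuousLinearMap.adjoint B)))

end Reducing

/-! ### The reducing condition and the exchange of operators -/

section Exchange

open Filter Topology

variable {H : Type*} [NormedAddCommGroup H] [InnerProductSpace ℂ H] [CompleteSpace H]

/-- If `T` is not injective, then the reducing condition forces `f 0 = 0`: apply it to a line `M` in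
`ker T°`, on which `0 = 0 e^{iθ}` for all `θ`, so that the single eigenvalue of an operator on `M`
equals `e^{-iθ} f(0)` for `θ = 0` and for `θ = π`. -/
theorem ReducingCondition.map_zero_of_apply_eq_zero {g : GeneralizedLimit} {T U : H →L[ℂ] H}
    {f : ℝ → ℝ} (h1 : ApproxEigenvectorCondition T) (h2 : ReducingCondition g T U f) {v : H}
    (hv : v ≠ 0) (hTv : T v = 0) : f 0 = 0 := by
  obtain ⟨u, hu, hTu⟩ : ∃ u, ‖u‖ = 1 ∧ T u = 0 :=
    ⟨((‖v‖⁻¹ : ℝ) : ℂ) • v, by simp [norm_smul, hv], by simp [hTv]⟩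
  have hTu' := h1 0 (fun _ => u) (fun _ => hu) (by simp [hTu])
  rw [zero_smul, sub_zero] at hTu'
  obtain ⟨y, hy0, hy⟩ := exists_ne_zero_berberianRep_eq_zero g (x := fun _ => u) fun _ => hu
  have hTy : berberianRep g T y = 0 := hy T (by simp [hTu])
  have hTy' : ContinuousLinearMap.adjoint (berberianRep g T) y = 0 := by
    rw [← berberianRep_adjoint]
    exact hy _ hTu'
  let M : ClosedSubmodule ℂ (BerberianSpace g H) :=
    ⟨Submodule.span ℂ {y}, Submodule.closed_of_finiteDimensional _⟩
  have hyM : y ∈ M.toSubmodule := Submodule.mem_span_singleton_self y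
  have hM (x : BerberianSpace g H) (hx : x ∈ M.toSubmodule) : ∃ c : ℂ, c • y = x :=
    Submodule.mem_span_singleton.mp hx
  have hred : Reduces M (berberianRep g T) := by
    refine ⟨fun x hx => ?_, fun x hx => ?_⟩ <;> obtain ⟨c, rfl⟩ := hM x hx
    · rw [map_smul, hTy, smul_zero]
      exact Submodule.zero_mem _
    · rw [map_smul, hTy', smul_zero]
      exact Submodule.zero_mem _
  have hspec (θ : ℝ) : ((0 : ℝ) : ℂ) * Complex.exp (Complex.I * θ) ∈ spectrum ℂ hred.restrict :=
    hred.mem_spectrum_restrict hyM hy0 (by simpa using hTy')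
  have heigen {B : M.toSubmodule →L[ℂ] M.toSubmodule} {μ : ℂ} (hμ : μ ∈ pointSpectrum B) :
      B ⟨y, hyM⟩ = μ • ⟨y, hyM⟩ := by
    obtain ⟨x, hx0, hx⟩ := hμ
    obtain ⟨c, hc⟩ := hM x x.2
    have hxc : x = c • (⟨y, hyM⟩ : M.toSubmodule) := Subtype.ext hc.symm
    have hc0 : c ≠ 0 := by
      rintro rfl
      exact hx0 (by rw [hxc, zero_smul])
    rw [hxc, map_smul, smul_comm] at hx
    exact smul_right_injective _ hc0 hx
  obtain ⟨hU, hP, h0⟩ := h2 M hred 0 0 le_rfl (hspec 0)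
  obtain ⟨_, _, hπ⟩ := h2 M hred 0 Real.pi le_rfl (hspec Real.pi)
  have heq := smul_left_injective ℂ
    (fun h => hy0 (congrArg Subtype.val h) : (⟨y, hyM⟩ : M.toSubmodule) ≠ 0)
    ((heigen h0).symm.trans (heigen hπ))
  have hexp : Complex.exp (-(Complex.I * Real.pi)) = -1 := by
    rw [mul_comm, Complex.exp_neg, Complex.exp_pi_mul_I]
    norm_num
  simp only [Complex.ofReal_zero, mul_zero, neg_zero, Complex.exp_zero, one_mul, hexp,
    neg_mul] at heq
  exact Complex.ofReal_eq_zero.mp (self_eq_neg.mp heq)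

/-- One step of the exchange: a nonzero common null vector of `(T° - z)^*` and of the adjoints of
operators `A_i` that commute with `T°` and its adjoint may be replaced by one of `(S° - w)^*` and
the `A_i^*`. The reducing condition is applied to the common kernel of the `A_i^*`. -/
theorem ReducingCondition.exists_ne_zero {g : GeneralizedLimit} {T U : H →L[ℂ] H}
    {f : ℝ → ℝ} (h2 : ReducingCondition g T U f) (hf : ContinuousOn f (spectrum ℝ (CFC.abs T)))
    {r θ : ℝ} (hr : 0 ≤ r) {ι : Type*} {A : ι → BerberianSpace g H →L[ℂ] BerberianSpace g H}
    (hA : ∀ i, Commute (berberianRep g T) (A i))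
    (hA' : ∀ i, Commute (berberianRep g T) (ContinuousLinearMap.adjoint (A i)))
    {x : BerberianSpace g H} (hx0 : x ≠ 0)
    (hx : ContinuousLinearMap.adjoint (berberianRep g
      (T - ((r : ℂ) * Complex.exp (Complex.I * θ)) • (1 : H →L[ℂ] H))) x = 0)
    (hAx : ∀ i, ContinuousLinearMap.adjoint (A i) x = 0) :
    ∃ y, y ≠ 0 ∧ ContinuousLinearMap.adjoint (berberianRep g (U * cfc f (CFC.abs T) -
      (Complex.exp (Complex.I * θ) * (f r : ℂ)) • (1 : H →L[ℂ] H))) y = 0 ∧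
      ∀ i, ContinuousLinearMap.adjoint (A i) y = 0 := by
  have hred := reduces_jointCokernel hA hA'
  have hspec : (r : ℂ) * Complex.exp (Complex.I * θ) ∈ spectrum ℂ hred.restrict := by
    refine hred.mem_spectrum_restrict (mem_jointCokernel.mpr hAx) hx0 ?_
    rwa [← berberianStarAlgHom_apply, map_sub, map_smul, map_one] at hx
  obtain ⟨hU, hP, y, hy0, hy⟩ := h2 _ hred r θ hr hspec
  refine ⟨y, fun h => hy0 (Subtype.ext h), ?_, mem_jointCokernel.mp y.2⟩
  have hP' : IsSelfAdjoint (CFC.abs T) := (CFC.abs_nonneg T).isSelfAdjoint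
  rw [← ContinuousLinearMap.star_eq_adjoint, star_mul, ContinuousLinearMap.star_eq_adjoint,
    ContinuousLinearMap.star_eq_adjoint] at hy
  have hy' := congrArg Subtype.val hy
  rw [mul_apply_eq_comp, Reduces.coe_adjoint_restrict,
    Reduces.coe_adjoint_restrict, ← berberianRep_cfc g hP' hf] at hy'
  rw [← berberianRep_adjoint, ← ContinuousLinearMap.star_eq_adjoint, star_sub, star_mul, star_smul,
    star_one, ContinuousLinearMap.star_eq_adjoint, ContinuousLinearMap.star_eq_adjoint,
    ← berberianStarAlgHom_apply, map_sub, map_mul, map_smul, map_one]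
  have hw : star (Complex.exp (Complex.I * θ) * (f r : ℂ)) =
      Complex.exp (-(Complex.I * θ)) * (f r : ℂ) := by
    simp [← Complex.exp_conj]
  rw [hw, sub_apply, mul_apply_eq_comp, berberianStarAlgHom_apply,
    berberianStarAlgHom_apply, berberianRep_adjoint, berberianRep_adjoint, hy']
  exact sub_self _

end Exchange

/-! ### The exchange at all indices -/

theorem theorem1p9 {H : Type*} [NormedAddCommGroup H] [InnerProductSpace ℂ H] [CompleteSpace H]
    (g : GeneralizedLimit) {n : ℕ} (T U : Fin n → H →L[ℂ] H) (hT : DoublyCommuting T)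
    (hU : ∀ j, U j ∈ unitary (H →L[ℂ] H)) (hpolar : ∀ j, T j = U j * CFC.abs (T j))
    (I : Set ℝ) (hI : I.OrdConnected) (hI0 : I ⊆ Set.Ici 0) (f : ℝ → ℝ) (hf : ContinuousOn f I)
    (hσ : ∀ j, spectrum ℝ (CFC.abs (T j)) ⊆ I)
    (h1 : ∀ j, ApproxEigenvectorCondition (T j))
    (h2 : ∀ j, ReducingCondition g (T j) (U j) f)
    (S : Fin n → H →L[ℂ] H) (hS : ∀ j, S j = U j * cfc f (CFC.abs (T j))) :
    (∀ i j, Commute (S i) (S j)) ∧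
      ∀ r θ : Fin n → ℝ, (∀ j, 0 ≤ r j) →
        (fun j => (r j : ℂ) * Complex.exp (Complex.I * θ j)) ∈ taylorSpectrum T →
        (fun j => Complex.exp (Complex.I * θ j) * (f (r j) : ℂ)) ∈ taylorSpectrum S := by
  have hfσ (j) : ContinuousOn f (spectrum ℝ (CFC.abs (T j))) := hf.mono (hσ j)
  have hcommS (j) {B : H →L[ℂ] H} (hB : Commute B (T j))
      (hB' : Commute B (ContinuousLinearMap.adjoint (T j))) : Commute B (S j) :=
    hS j ▸ hB.mul_cfc_abs (hpolar j) (hfσ j)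
      (fun v hv hTv => (h2 j).map_zero_of_apply_eq_zero (h1 j) hv hTv) hB'
  have hTS {i j} (hij : i ≠ j) : Commute (T i) (S j) := hcommS j (hT i j hij).1 (hT i j hij).2
  have hTS' {i j} (hij : i ≠ j) : Commute (T i) (ContinuousLinearMap.adjoint (S j)) := by
    have h : Commute (ContinuousLinearMap.adjoint (T i)) (S j) :=
      hcommS j (hT j i hij.symm).2.symm (hT i j hij).1.star_star
    have := h.star_star
    rwa [← ContinuousLinearMap.star_eq_adjoint, star_star] at this
  refine ⟨fun i j => ?_, fun r θ hr hz => ?_⟩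
  · rcases eq_or_ne i j with rfl | hij
    · exact Commute.refl _
    · have h := (hTS' hij.symm).star_star
      rw [← ContinuousLinearMap.star_eq_adjoint, star_star] at h
      exact hcommS j (hTS hij.symm).symm h.symm
  set z : Fin n → ℂ := fun j => (r j : ℂ) * Complex.exp (Complex.I * θ j) with hzdef
  set w : Fin n → ℂ := fun j => Complex.exp (Complex.I * θ j) * (f (r j) : ℂ) with hwdef
  -- the operators in which `T_j - z_j` has been exchanged for `S_j - w_j` for the `j` in `s`
  let A (s : Finset (Fin n)) (j : Fin n) : H →L[ℂ] H :=
    if j ∈ s then S j - w j • (1 : H →L[ℂ] H) else T j - z j • (1 : H →L[ℂ] H)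
  have hscalar (c : ℂ) (B : H →L[ℂ] H) : Commute B (c • (1 : H →L[ℂ] H)) :=
    (Commute.one_right B).smul_right c
  have hTA (s : Finset (Fin n)) {i j : Fin n} (hij : i ≠ j) : Commute (T i) (A s j) := by
    by_cases hj : j ∈ s
    · simp only [A, if_pos hj]
      exact (hTS hij).sub_right (hscalar _ _)
    · simp only [A, if_neg hj]
      exact (hT i j hij).1.sub_right (hscalar _ _)
  have hTA' (s : Finset (Fin n)) {i j : Fin n} (hij : i ≠ j) :
      Commute (T i) (ContinuousLinearMap.adjoint (A s j)) := by
    by_cases hj : j ∈ s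
    · simp only [A, if_pos hj]
      rw [← ContinuousLinearMap.star_eq_adjoint, star_sub, star_smul, star_one]
      exact (hTS' hij).sub_right (hscalar _ _)
    · simp only [A, if_neg hj]
      rw [← ContinuousLinearMap.star_eq_adjoint, star_sub, star_smul, star_one]
      exact (hT i j hij).2.sub_right (hscalar _ _)
  have hvec (s : Finset (Fin n)) : ∃ y : BerberianSpace g H, y ≠ 0 ∧
      ∀ j, ContinuousLinearMap.adjoint (berberianRep g (A s j)) y = 0 := by
    induction s using Finset.induction_on with
    | empty =>
      obtain ⟨x, hx1, hx⟩ := exists_unit_seq_of_mem_taylorSpectrum hT h1 hz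
      obtain ⟨y, hy0, hy⟩ := exists_ne_zero_berberianRep_eq_zero g hx1
      refine ⟨y, hy0, fun j => ?_⟩
      rw [← berberianRep_adjoint]
      exact hy _ (by simpa [A] using hx j)
    | insert k s hk ih =>
      obtain ⟨x, hx0, hx⟩ := ih
      obtain ⟨y, hy0, hyk, hy⟩ := (h2 k).exists_ne_zero (hfσ k) (hr k) (θ := θ k)
        (A := fun j : {j // j ≠ k} => berberianRep g (A s j))
        (fun j => (hTA s j.2.symm).map (berberianStarAlgHom g))
        (fun j => by
          rw [← berberianRep_adjoint]
          exact (hTA' s j.2.symm).map (berberianStarAlgHom g))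
        hx0 (by simpa [A, hk] using hx k) fun j => hx j
      refine ⟨y, hy0, fun j => ?_⟩
      rcases eq_or_ne j k with rfl | hjk
      · simpa [A, hS] using hyk
      · simpa [A, hjk] using hy ⟨j, hjk⟩
  obtain ⟨y, hy0, hy⟩ := hvec Finset.univ
  intro hexact
  have hunit := (isUnit_sum_mul_adjoint_of_surjective hexact.1).map (berberianStarAlgHom g)
  rw [ContinuousLinearMap.isUnit_iff_bijective] at hunit
  refine hy0 (hunit.1 (Eq.trans ?_ (map_zero _).symm))
  rw [map_sum, sum_apply]
  refine Finset.sum_eq_zero fun j _ => ?_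
  have hj := hy j
  simp only [A, Finset.mem_univ, if_true] at hj
  rw [map_mul, mul_apply_eq_comp, berberianStarAlgHom_apply,
    berberianStarAlgHom_apply, berberianRep_adjoint, hj, map_zero]
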